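/- Throughout, $d\ge 1$ and $\hbar>0$. **Admissible entropies.** $S:[0,1]\to\mathbb R_+$ is an *admissible entropy functional* on $\mathbb R^d$ if $S$ is continuous on $[0,1]$ and differentiable on $(0,1)$; $-S'$ is operator monotone on $(0,1)$ and not constant; $\lim_{m\to0}S'(m)=+\infty$ and $\lim_{m\to1}S'(m)\le 0$; and $m\mapsto m\,S''(m)\,S'(m)^{d/2-1}$ is integrable on $\{m\in(0,1): S'(m)>0\}$ (equivalently, $v\mapsto (S')^{-1}(|v|^2)$ is integrable on $\mathbb R^d$). **Relative entropies.** For $y\in[0,1]$ put $\mathcal H_S(y,y_0)=S'(y_0)(y-y_0)-S(y)+S(y_0)$ if $y_0\in(0,1)$, and $\mathcal H_S(y,y_0)=\sup_{0<\theta<1}\frac1\theta\big(S(\theta y+(1-\theta)y_0)-(1-\theta)S(y_0)-\theta S(y)\big)$ if $y_0\in\{0,1\}$. For Hermitian matrices $0\le A,B\le1$ put $\mathcal H_S(A,B)=-\operatorname{tr}\big(S(A)-S(B)-S'(B)(A-B)\big)$ if the spectrum of $B$ lies in $(0,1)$, and $\mathcal H_S(A,B)=\sup_{0<\theta<1}\frac1\theta\operatorname{tr}\big(S(\theta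 A+(1-\theta)B)-(1-\theta)S(B)-\theta S(A)\big)$ otherwise. For self-adjoint operators $0\le A,B\le 1$ on a Hilbert space, $\mathcal H_S(A,B)\in[0,+\infty]$ is the supremum of $\mathcal H_S(PAP,PBP)$ over the finite-rank orthogonal projections $P$, where $PAP$, $PBP$ are seen as operators on the range of $P$; it is also the limit along any increasing sequence of such projections tending strongly to the identity. For measurable $m,m_0:\mathbb R^d\times\mathbb R^d\to[0,1]$ put $$\mathcal H^{\rm cl}_S(m,m_0)=\frac1{(2\pi)^d}\iint_{\mathbb R^d\times\mathbb R^d}\mathcal H_S\big(m(x,v),m_0(x,v)\big)\,dx\,dv .$$ **Berezin–Lieb property.** $S$ has the Berezin–Lieb property on $[0,1]$ with constant $C_S^{BL}>0$ if, for every complex Hilbert space $\mathfrak H$, every $N$, every non-negative Borel measure $\zeta$ on $\mathbb R^N$ and every continuous map $x\mapsto n_x$ from $\mathbb R^N$ to the unit vectors of $\mathfrak H$ with $\int_{\mathbb R^N}|n_x\rangle\langle n_x|\,d\zeta(x)=\mathrm{id}_{\mathfrak H}$ (weakly), one has $$\int_{\mathbb R^N}\mathcal H_S\big(\langle n_x,An_x\rangle,\langle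 n_x,Bn_x\rangle\big)\,d\zeta(x)\le C_S^{BL}\,\mathcal H_S(A,B)$$ for all bounded self-adjoint operators $A,B$ on $\mathfrak H$ with spectrum in $[0,1]$. **Reference state, energy space, Husimi transform.** Let $\gamma_{\rm ref}=(S')^{-1}(-\hbar^2\Delta)$ on $L^2(\mathbb R^d)$, i.e. the Fourier multiplier $\widehat{\gamma_{\rm ref}u}(\xi)=(S')^{-1}(\hbar^2|\xi|^2)\,\widehat u(\xi)$ with $\widehat u(\xi)=(2\pi)^{-d/2}\int u(x)e^{-ix\cdot\xi}\,dx$, and let $$\mathcal K_S^\hbar=\{\gamma=\gamma^*\text{ on }L^2(\mathbb R^d):\ 0\le\gamma\le1,\ \mathcal H_S(\gamma,\gamma_{\rm ref})<+\infty\}.$$ Fix $\chi\in L^2(\mathbb R^d,\mathbb R)$ with $\int\chi^2=1$, let $\chi^\hbar_{x,v}(z)=\hbar^{-d/4}\chi\big(\hbar^{-1/2}(z-x)\big)e^{iv\cdot z/\hbar}$, and let $m^\hbar_\gamma(x,v)=\langle\chi^\hbar_{x,v},\gamma\chi^\hbar_{x,v}\rangle$ be the Husimi transform of $\gamma$. **Proposition.**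 Let $S$ be an admissible entropy functional having the Berezin–Lieb property on $[0,1]$ with constant $C_S^{BL}$. Then for every $\gamma\in\mathcal K_S^\hbar$, $$\mathcal H^{\rm cl}_S\big(m^\hbar_\gamma,m^\hbar_{\gamma_{\rm ref}}\big)\le C_S^{BL}\,\hbar^d\,\mathcal H_S(\gamma,\gamma_{\rm ref}).$$ -/

import Mathlib

open MeasureTheory Filter Topology
open scoped ENNReal FourierTransform ComplexOrder

noncomputable section

namespace BerezinLieb

/-- The position (or velocity) space `ℝ^d`. -/
abbrev Space (d : ℕ) : Type := EuclideanSpace ℝ (Fin d)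

/-- The complex Hilbert space `L²(ℝ^d)`. -/
abbrev L2 (d : ℕ) : Type := Lp ℂ 2 (volume : Measure (Space d))

/-! ### Admissible entropy functionals -/

/-- `f` is operator monotone on `I`: for Hermitian matrices `A ≤ B` of any size with spectrum in
`I`, one has `f(A) ≤ f(B)` (functional calculus, Loewner order). -/
def OperatorMonotoneOn (f : ℝ → ℝ) (I : Set ℝ) : Prop :=
  ∀ (n : ℕ) (A B : Matrix (Fin n) (Fin n) ℂ), A.IsHermitian → B.IsHermitian →
    spectrum ℝ A ⊆ I → spectrum ℝ B ⊆ I → (B - A).PosSemidef → (cfc f B - cfc f A).PosSemidef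

/-- Admissible entropy functionals `S : [0,1] → ℝ₊` on `ℝ^d`. Only the values of `S` on `[0,1]`
matter. The last field says that `(S')⁻¹(|v|²)` is integrable over `v ∈ ℝ^d`, in the variable
`m = (S')⁻¹(|v|²)`: the function `m S''(m) S'(m)^{d/2-1}` is integrable where `S' > 0`. -/
structure AdmissibleEntropy (d : ℕ) (S : ℝ → ℝ) : Prop where
  nonneg : ∀ m ∈ Set.Icc (0 : ℝ) 1, 0 ≤ S m
  continuousOn : ContinuousOn S (Set.Icc 0 1)
  differentiableOn : DifferentiableOn ℝ S (Set.Ioo 0 1)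
  operatorMonotone : OperatorMonotoneOn (fun m => -deriv S m) (Set.Ioo 0 1)
  not_constant : ¬ ∃ c : ℝ, ∀ m ∈ Set.Ioo (0 : ℝ) 1, -deriv S m = c
  tendsto_zero : Tendsto (deriv S) (𝓝[>] 0) atTop
  tendsto_one : ∃ l : EReal, l ≤ 0 ∧ Tendsto (fun m => ((deriv S m : ℝ) : EReal)) (𝓝[<] 1) (𝓝 l)
  finite_density : IntegrableOn
    (fun m => m * deriv (deriv S) m * (deriv S m) ^ ((d : ℝ) / 2 - 1))
    {m | m ∈ Set.Ioo (0 : ℝ) 1 ∧ 0 < deriv S m}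

/-! ### Relative entropies -/

open Classical in
/-- The relative entropy `𝓗_S(y, y₀)` of two numbers `y, y₀ ∈ [0,1]`. -/
def scalarRelEntropy (S : ℝ → ℝ) (y y₀ : ℝ) : ℝ≥0∞ :=
  if y₀ ∈ Set.Ioo (0 : ℝ) 1 then
    ENNReal.ofReal (deriv S y₀ * (y - y₀) - S y + S y₀)
  else
    ⨆ θ ∈ Set.Ioo (0 : ℝ) 1,
      ENNReal.ofReal (1 / θ * (S (θ * y + (1 - θ) * y₀) - (1 - θ) * S y₀ - θ * S y))

open Classical in
/-- The relative entropy `𝓗_S(A, B) = -tr (S(A) - S(B) - S'(B)(A - B))` of two Hermitian matrices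
with spectrum in `[0,1]`. If `B` has `0` or `1` as an eigenvalue, where `S'` need not be defined,
it is the supremum (which is also the limit `θ → 0`) of the difference quotients, as for numbers. -/
def matrixRelEntropy (S : ℝ → ℝ) {n : ℕ} (A B : Matrix (Fin n) (Fin n) ℂ) : ℝ≥0∞ :=
  if spectrum ℝ B ⊆ Set.Ioo (0 : ℝ) 1 then
    ENNReal.ofReal (-(cfc S A - cfc S B - cfc (deriv S) B * (A - B)).trace.re)
  else
    ⨆ θ ∈ Set.Ioo (0 : ℝ) 1,
      ENNReal.ofReal (1 / θ *
        (cfc S (θ • A + (1 - θ) • B) - (1 - θ) • cfc S B - θ • cfc S A).trace.re)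

section Hilbert

variable {H : Type*} [NormedAddCommGroup H] [InnerProductSpace ℂ H]

/-- The matrix of the compression `P A P` to the span of the orthonormal family `e`, where `P` is
the orthogonal projection onto that span. -/
def compression {n : ℕ} (e : Fin n → H) (A : H →L[ℂ] H) : Matrix (Fin n) (Fin n) ℂ :=
  Matrix.of fun i j => inner ℂ (e i) (A (e j))

/-- The quantum relative entropy `𝓗_S(A, B) ∈ [0, ∞]` of two self-adjoint operators `0 ≤ A, B ≤ 1`
on a Hilbert space: the supremum of `𝓗_S(P A P, P B P)` over all orthogonal projections `P` of
finite rank, the compressions being taken as operators on the range of `P`. As the relative entropy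
grows with `P`, this is the limit of `𝓗_S(P_k A P_k, P_k B P_k)` along any increasing
sequence of finite-rank projections that tends strongly to the identity. -/
def quantumRelEntropy (S : ℝ → ℝ) (A B : H →L[ℂ] H) : ℝ≥0∞ :=
  ⨆ (n : ℕ) (e : Fin n → H) (_ : Orthonormal ℂ e),
    matrixRelEntropy S (compression e A) (compression e B)

/-- `∫ |n_x⟩⟨n_x| dζ(x) = id`, in the weak sense. -/
def IsResolutionOfIdentity {X : Type*} [MeasurableSpace X] (ζ : Measure X) (n : X → H) : Prop :=
  ∀ u w : H, Integrable (fun x => inner ℂ u (n x) * inner ℂ (n x) w) ζ ∧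
    ∫ x, inner ℂ u (n x) * inner ℂ (n x) w ∂ζ = inner ℂ u w

end Hilbert

/-- The Berezin-Lieb property of `S` on `[0,1]` with constant `C`. -/
def HasBerezinLiebProperty (S : ℝ → ℝ) (C : ℝ) : Prop :=
  0 < C ∧
  ∀ (H : Type) [NormedAddCommGroup H] [InnerProductSpace ℂ H] [CompleteSpace H]
    (N : ℕ) (ζ : Measure (EuclideanSpace ℝ (Fin N))) (n : EuclideanSpace ℝ (Fin N) → H),
    Continuous n → (∀ x, ‖n x‖ = 1) → IsResolutionOfIdentity ζ n →
    ∀ A B : H →L[ℂ] H, IsSelfAdjoint A → IsSelfAdjoint B →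
      spectrum ℝ A ⊆ Set.Icc 0 1 → spectrum ℝ B ⊆ Set.Icc 0 1 →
      ∫⁻ x, scalarRelEntropy S (inner ℂ (n x) (A (n x))).re (inner ℂ (n x) (B (n x))).re ∂ζ
        ≤ ENNReal.ofReal C * quantumRelEntropy S A B

/-- The classical relative entropy of `m, m₀ : ℝ^d × ℝ^d → [0,1]`:
`(2π)^{-d} ∬ 𝓗_S(m(x,v), m₀(x,v)) dx dv`. -/
def classicalRelEntropy {d : ℕ} (S : ℝ → ℝ) (m m₀ : Space d × Space d → ℝ) : ℝ≥0∞ :=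
  ENNReal.ofReal (1 / (2 * Real.pi) ^ d) * ∫⁻ z, scalarRelEntropy S (m z) (m₀ z)

/-! ### The reference state and the free energy space -/

/-- The inverse `(S')⁻¹` of the non-increasing function `S'` on `(0,1)`, as a function `ℝ → [0,1]`.
It is written as a generalized inverse; see `deriv_invDeriv`. -/
def invDeriv (S : ℝ → ℝ) (y : ℝ) : ℝ :=
  sSup {m | m ∈ Set.Ioo (0 : ℝ) 1 ∧ y ≤ deriv S m}

lemma invDeriv_nonneg (S : ℝ → ℝ) (y : ℝ) : 0 ≤ invDeriv S y :=
  Real.sSup_nonneg fun _ hm => hm.1.1.le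

lemma invDeriv_le_one (S : ℝ → ℝ) (y : ℝ) : invDeriv S y ≤ 1 :=
  Real.sSup_le (fun _ hm => hm.1.2.le) zero_le_one

lemma invDeriv_antitone (S : ℝ → ℝ) : Antitone (invDeriv S) := by
  intro y y' h
  refine Real.sSup_le (fun m hm => ?_) (invDeriv_nonneg S y)
  exact le_csSup ⟨1, fun _ hm => hm.1.2.le⟩ ⟨hm.1, h.trans hm.2⟩

/-- An operator monotone function is monotone. -/
lemma OperatorMonotoneOn.monotoneOn {f : ℝ → ℝ} {I : Set ℝ} (hf : OperatorMonotoneOn f I) :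
    MonotoneOn f I := by
  intro a ha b hb hab
  have hs : ∀ c ∈ I, spectrum ℝ (algebraMap ℝ (Matrix (Fin 1) (Fin 1) ℂ) c) ⊆ I := by
    intro c hc
    rw [spectrum.scalar_eq]
    simpa using hc
  have hh : ∀ c : ℝ, (algebraMap ℝ (Matrix (Fin 1) (Fin 1) ℂ) c).IsHermitian := fun c =>
    (IsSelfAdjoint.all c).algebraMap _
  have h := hf 1 _ _ (hh a) (hh b) (hs a ha) (hs b hb) (by
    rw [← map_sub]
    have hd : algebraMap ℝ (Matrix (Fin 1) (Fin 1) ℂ) (b - a)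
        = Matrix.diagonal fun _ => ((b - a : ℝ) : ℂ) := by
      ext i j; simp [Matrix.algebraMap_matrix_apply, Matrix.diagonal_apply]
    rw [hd, Matrix.posSemidef_diagonal_iff]
    intro _
    exact_mod_cast sub_nonneg.2 hab)
  rw [cfc_algebraMap, cfc_algebraMap, ← map_sub] at h
  have hd : algebraMap ℝ (Matrix (Fin 1) (Fin 1) ℂ) (f b - f a)
      = Matrix.diagonal fun _ => ((f b - f a : ℝ) : ℂ) := by
    ext i j; simp [Matrix.algebraMap_matrix_apply, Matrix.diagonal_apply]
  rw [hd, Matrix.posSemidef_diagonal_iff] at h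
  have := h 0
  exact sub_nonneg.1 (by exact_mod_cast this)

/-- `invDeriv S` is the inverse of `S'`: every `y > 0` is the value of `S'` at
`invDeriv S y ∈ (0,1)`. -/
lemma deriv_invDeriv {d : ℕ} {S : ℝ → ℝ} (hS : AdmissibleEntropy d S) {y : ℝ} (hy : 0 < y) :
    invDeriv S y ∈ Set.Ioo (0 : ℝ) 1 ∧ deriv S (invDeriv S y) = y := by
  have hanti : ∀ {a b : ℝ}, a ∈ Set.Ioo (0 : ℝ) 1 → b ∈ Set.Ioo (0 : ℝ) 1 → a ≤ b →
      deriv S b ≤ deriv S a := fun ha hb hab => by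
    simpa using hS.operatorMonotone.monotoneOn ha hb hab
  have darboux : ∀ {a b c : ℝ}, a ∈ Set.Ioo (0 : ℝ) 1 → b ∈ Set.Ioo (0 : ℝ) 1 → a ≤ b →
      c < deriv S a → deriv S b < c → ∃ t ∈ Set.Ioo a b, deriv S t = c := by
    intro a b c ha hb hab h1 h2
    refine exists_hasDerivWithinAt_eq_of_lt_of_gt hab (f := S) (fun x hx => ?_) h1 h2
    have hx' : x ∈ Set.Ioo (0 : ℝ) 1 := ⟨ha.1.trans_le hx.1, hx.2.trans_lt hb.2⟩
    exact ((hS.differentiableOn x hx').differentiableAt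
      (isOpen_Ioo.mem_nhds hx')).hasDerivAt.hasDerivWithinAt
  obtain ⟨a, hya, ha⟩ := ((hS.tendsto_zero.eventually_gt_atTop y).and
    (Ioo_mem_nhdsGT (zero_lt_one' ℝ))).exists
  obtain ⟨l, hl, hlim⟩ := hS.tendsto_one
  obtain ⟨b, hyb, hb⟩ := ((hlim.eventually_lt_const
    (hl.trans_lt (EReal.coe_pos.2 hy))).and (Ioo_mem_nhdsLT (zero_lt_one' ℝ))).exists
  have hyb' : deriv S b < y := EReal.coe_lt_coe_iff.1 hyb
  have hlt : ∀ {m c : ℝ}, m ∈ Set.Ioo (0 : ℝ) 1 → c ∈ Set.Ioo (0 : ℝ) 1 → y ≤ deriv S m →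
      deriv S c < y → m ≤ c := fun hm hc h1 h2 =>
    le_of_not_gt fun h => absurd (hanti hc hm h.le) (not_le.2 (h2.trans_le h1))
  obtain ⟨m₀, hm₀, hy₀⟩ := darboux ha hb (hlt ha hb hya.le hyb') hya hyb'
  have hm₀' : m₀ ∈ Set.Ioo (0 : ℝ) 1 := ⟨ha.1.trans hm₀.1, hm₀.2.trans hb.2⟩
  have hle : m₀ ≤ invDeriv S y := le_csSup ⟨1, fun _ hm => hm.1.2.le⟩ ⟨hm₀', hy₀.ge⟩
  have hsup : ∀ {c : ℝ}, c ∈ Set.Ioo (0 : ℝ) 1 → deriv S c < y → invDeriv S y ≤ c :=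
    fun hc h => csSup_le ⟨m₀, hm₀', hy₀.ge⟩ fun m hm => hlt hm.1 hc hm.2 h
  have hs : invDeriv S y ∈ Set.Ioo (0 : ℝ) 1 :=
    ⟨hm₀'.1.trans_le hle, (hsup hb hyb').trans_lt hb.2⟩
  refine ⟨hs, le_antisymm ((hanti hm₀' hs hle).trans_eq hy₀) (le_of_not_gt fun h => ?_)⟩
  obtain ⟨t, ht, hty⟩ := darboux (c := (deriv S (invDeriv S y) + y) / 2) hm₀' hs hle
    (by linarith) (by linarith)
  exact absurd (hsup ⟨hm₀'.1.trans ht.1, ht.2.trans hs.2⟩ (by linarith)) (not_le.2 ht.2)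

/-- The symbol of `(S')⁻¹(-ħ²Δ)`. In the normalization `∫ u(x) e^{-2πi x·ξ} dx` of the Fourier
transform, `-ħ²Δ` is the multiplication by `(2πħ|ξ|)²`. -/
def refSymbol (d : ℕ) (S : ℝ → ℝ) (ħ : ℝ) (ξ : Space d) : ℂ :=
  (invDeriv S ((2 * Real.pi * ħ * ‖ξ‖) ^ 2) : ℂ)

lemma memLp_refSymbol (d : ℕ) (S : ℝ → ℝ) (ħ : ℝ) :
    MemLp (refSymbol d S ħ) ∞ (volume : Measure (Space d)) := by
  have hm : Measurable (refSymbol d S ħ) := by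
    unfold refSymbol
    exact Complex.measurable_ofReal.comp ((invDeriv_antitone S).measurable.comp (by fun_prop))
  refine memLp_top_of_bound hm.aestronglyMeasurable 1 (ae_of_all _ fun ξ => ?_)
  simp only [refSymbol, Complex.norm_real, Real.norm_eq_abs, abs_of_nonneg (invDeriv_nonneg S _)]
  exact invDeriv_le_one S _

/-- The reference state `γ_ref = (S')⁻¹(-ħ²Δ)`, as a Fourier multiplier on `L²(ℝ^d)`. -/
def refState (d : ℕ) (S : ℝ → ℝ) (ħ : ℝ) : L2 d →L[ℂ] L2 d :=
  (((Lp.fourierTransformₗᵢ (Space d) ℂ).symm.toContinuousLinearEquiv :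
      L2 d ≃L[ℂ] L2 d) : L2 d →L[ℂ] L2 d) ∘L
    (((ContinuousLinearMap.mul ℂ ℂ).holderL volume ∞ 2 2) (memLp_refSymbol d S ħ).toLp) ∘L
    (((Lp.fourierTransformₗᵢ (Space d) ℂ).toContinuousLinearEquiv :
      L2 d ≃L[ℂ] L2 d) : L2 d →L[ℂ] L2 d)

/-- The Fourier transform turns `γ_ref` into the multiplication by its symbol. -/
lemma fourier_refState (d : ℕ) (S : ℝ → ℝ) (ħ : ℝ) (u : L2 d) :
    (𝓕 (refState d S ħ u) : L2 d) =ᵐ[volume] fun ξ => refSymbol d S ħ ξ * (𝓕 u : L2 d) ξ := by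
  have h : (𝓕 (refState d S ħ u) : L2 d) =
      (ContinuousLinearMap.mul ℂ ℂ).holder 2 (memLp_refSymbol d S ħ).toLp (𝓕 u : L2 d) :=
    (Lp.fourierTransformₗᵢ (Space d) ℂ).apply_symm_apply _
  rw [h]
  filter_upwards [(ContinuousLinearMap.mul ℂ ℂ).coeFn_holder (r := 2)
    (memLp_refSymbol d S ħ).toLp (𝓕 u : L2 d), (memLp_refSymbol d S ħ).coeFn_toLp] with ξ h1 h2
  rw [h1, h2]
  rfl

/-- The semi-classical free energy space. -/
def freeEnergySpace (d : ℕ) (S : ℝ → ℝ) (ħ : ℝ) : Set (L2 d →L[ℂ] L2 d) :=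
  {γ | IsSelfAdjoint γ ∧ 0 ≤ γ ∧ γ ≤ 1 ∧ quantumRelEntropy S γ (refState d S ħ) < ∞}

/-! ### The Husimi transform -/

/-- The function `z ↦ χ^ħ(z - x) e^{i v·z/ħ}` with `χ^ħ(z) = ħ^{-d/4} χ(ħ^{-1/2} z)`. -/
def coherentFun {d : ℕ} (χ : Space d → ℝ) (ħ : ℝ) (x v z : Space d) : ℂ :=
  ((ħ ^ (-(d : ℝ) / 4) * χ (ħ ^ (-(1 / 2) : ℝ) • (z - x)) : ℝ) : ℂ) *
    Complex.exp (Complex.I * ((inner ℝ v z / ħ : ℝ) : ℂ))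

lemma memLp_coherentFun {d : ℕ} {χ : Space d → ℝ} (hχ : MemLp χ 2) {ħ : ℝ} (hħ : 0 < ħ)
    (x v : Space d) : MemLp (coherentFun χ ħ x v) 2 := by
  have hc : ħ ^ (-(1 / 2) : ℝ) ≠ 0 := (Real.rpow_pos_of_pos hħ _).ne'
  have hmap : Measure.map (fun z : Space d => ħ ^ (-(1 / 2) : ℝ) • z) volume =
      ENNReal.ofReal |((ħ ^ (-(1 / 2) : ℝ)) ^ Module.finrank ℝ (Space d))⁻¹| • volume :=
    Measure.map_addHaar_smul volume hc
  have h1 : MemLp (fun z => χ (ħ ^ (-(1 / 2) : ℝ) • z)) 2 (volume : Measure (Space d)) := by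
    refine (memLp_map_measure_iff (g := χ) ?_ (by fun_prop)).1 ?_
    · rw [hmap]; exact hχ.1.smul_measure _
    · rw [hmap]; exact hχ.smul_measure ENNReal.ofReal_ne_top
  have h2 : MemLp (fun z => χ (ħ ^ (-(1 / 2) : ℝ) • (z - x))) 2 (volume : Measure (Space d)) :=
    h1.comp_measurePreserving (measurePreserving_sub_right volume x)
  have h3 : MemLp (fun z => ((ħ ^ (-(d : ℝ) / 4) * χ (ħ ^ (-(1 / 2) : ℝ) • (z - x)) : ℝ) : ℂ)) 2
      (volume : Measure (Space d)) := (h2.const_mul _).ofReal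
  refine h3.of_le (h3.1.mul ?_) (ae_of_all _ fun z => ?_)
  · exact Continuous.aestronglyMeasurable (by fun_prop)
  · rw [coherentFun, norm_mul, mul_comm Complex.I, Complex.norm_exp_ofReal_mul_I, mul_one]

/-- The coherent state `χ^ħ_{x,v}`, as a vector of `L²(ℝ^d)`. -/
def coherentState {d : ℕ} {χ : Space d → ℝ} (hχ : MemLp χ 2) {ħ : ℝ} (hħ : 0 < ħ)
    (x v : Space d) : L2 d :=
  (memLp_coherentFun hχ hħ x v).toLp

/-- The Husimi transform `m^ħ_γ(x,v) = ⟨χ^ħ_{x,v}, γ χ^ħ_{x,v}⟩`. It is real for self-adjoint `γ`,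
the only case that is used. -/
def husimi {d : ℕ} {χ : Space d → ℝ} (hχ : MemLp χ 2) {ħ : ℝ} (hħ : 0 < ħ)
    (γ : L2 d →L[ℂ] L2 d) (z : Space d × Space d) : ℝ :=
  (inner ℂ (coherentState hχ hħ z.1 z.2) (γ (coherentState hχ hħ z.1 z.2))).re

end BerezinLieb

end

/-!
The coherent states `χ_{x,v}` form a continuous family of unit vectors that resolves the identity of
`L²(ℝ^d)` with respect to `(2πħ)^{-d} dx dv` on phase space. Applying the Berezin-Lieb property to
this family, with `A = γ` and `B = γ_ref`, gives the claim: the two sides differ from the inequality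
obtained by the factor `ħ^d` between `(2πħ)^{-d}` and `(2π)^{-d}`.

The resolution of the identity (`isResolutionOfIdentity_coherentState`) comes from the fact that
`⟨χ_{x,v}, w⟩` is, as a function of `v`, a rescaled Fourier integral of `χ(· - x) w`
(`inner_coherentState`). This product is integrable for all `x` and square integrable for almost
all `x`, so Plancherel's theorem in `v` and Tonelli's theorem in `(x, z)` show that
`w ↦ ⟨χ_{x,v}, w⟩` is isometric up to the factor `(2πħ)^d`
(`lintegral_enorm_inner_coherentState_sq`), and a linear isometry preserves inner products. As the
Fourier transform on `L²` is defined by density, it is first identified with the Fourier integral on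
`L¹ ∩ L²` (`fourier_toLp_ae_eq`).

The other hypotheses of the Berezin-Lieb property are the norm continuity of `χ_{x,v}` in `(x,v)`
(`continuous_coherentState`) and the bounds `0 ≤ γ_ref ≤ 1`, which hold because the symbol of
`γ_ref` takes values in `[0,1]`.
-/

noncomputable section

namespace BerezinLieb

/-! ### The Fourier transform on `L¹ ∩ L²` -/

section Fourier

variable {E : Type*} [NormedAddCommGroup E] [InnerProductSpace ℝ E] [FiniteDimensional ℝ E]
  [MeasurableSpace E] [BorelSpace E]

/-- On `L¹ ∩ L²`, the Fourier integral represents the Fourier transform defined on `L²` by density: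
both define the same tempered distribution. -/
lemma fourier_toLp_ae_eq {f : E → ℂ} (hf : Integrable f) (hf2 : MemLp f 2) :
    (𝓕 (hf2.toLp f) : Lp ℂ 2 (volume : Measure E)) =ᵐ[volume] 𝓕 f := by
  have hcont : Continuous (𝓕 f) := VectorFourier.fourierIntegral_continuous
    Real.continuous_fourierChar (by exact continuous_inner) hf
  refine ae_eq_of_integral_contDiff_smul_eq ((Lp.memLp _).locallyIntegrable (by norm_num))
    hcont.locallyIntegrable fun g g_smooth g_cpt => ?_
  have hg₁ : HasCompactSupport (Complex.ofRealCLM ∘ g) := g_cpt.comp_left rfl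
  have hg₂ : ContDiff ℝ (⊤ : ℕ∞) (Complex.ofRealCLM ∘ g) :=
    Complex.ofRealCLM.contDiff.comp g_smooth
  set G : SchwartzMap E ℂ := hg₁.toSchwartzMap hg₂ with hG
  have hGg : ∀ x, G x = (g x : ℂ) := fun x => rfl
  have h1 : ∫ x, g x • (𝓕 (hf2.toLp f) : Lp ℂ 2 (volume : Measure E)) x
      = ∫ x, (𝓕 G) x • f x := by
    have h := congrArg (fun T => T G) (Lp.fourier_toTemperedDistribution_eq (hf2.toLp f))
    simp only [TemperedDistribution.fourier_apply, Lp.toTemperedDistribution_apply] at h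
    calc _ = ∫ x, G x • (𝓕 (hf2.toLp f) : Lp ℂ 2 (volume : Measure E)) x := by
          simp [hGg]
      _ = ∫ x, (𝓕 G) x • (hf2.toLp f) x := h.symm
      _ = _ := integral_congr_ae (hf2.coeFn_toLp.mono fun x hx => by simp only [hx])
  have h2 : ∫ x, (𝓕 (G : E → ℂ)) x • f x = ∫ x, G x • (𝓕 f) x :=
    VectorFourier.integral_fourierIntegral_smul_eq_flip (L := innerₗ E)
      Real.continuous_fourierChar continuous_inner G.integrable hf |>.trans (by
        rw [flip_innerₗ]; rfl)
  rw [h1, SchwartzMap.fourier_coe, h2]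
  simp [hGg]

lemma sq_norm_toLp {α : Type*} [MeasurableSpace α] {μ : Measure α} {f : α → ℂ}
    (hf : MemLp f 2 μ) : ‖hf.toLp f‖ ^ 2 = ∫ x, ‖f x‖ ^ 2 ∂μ := by
  have h : inner ℂ (hf.toLp f) (hf.toLp f) = ∫ x, ((‖f x‖ ^ 2 : ℝ) : ℂ) ∂μ := by
    rw [L2.inner_def]
    refine integral_congr_ae (hf.coeFn_toLp.mono fun x hx => ?_)
    simp only [hx, inner_self_eq_norm_sq_to_K]
    push_cast; rfl
  rw [inner_self_eq_norm_sq_to_K, integral_complex_ofReal] at h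
  exact Complex.ofReal_injective (by push_cast at h ⊢; exact h)

lemma sq_eLpNorm_two {α : Type*} [MeasurableSpace α] (μ : Measure α) (f : α → ℂ) :
    eLpNorm f 2 μ ^ 2 = ∫⁻ x, ‖f x‖ₑ ^ 2 ∂μ := by
  simpa using eLpNorm_nnreal_pow_eq_lintegral (f := f) (μ := μ) (p := 2) (by norm_num)

/-- **Plancherel's theorem** for the Fourier integral on `L¹ ∩ L²`. -/
lemma lintegral_enorm_fourier_sq {f : E → ℂ} (hf : Integrable f) (hf2 : MemLp f 2) :
    ∫⁻ ξ, ‖𝓕 f ξ‖ₑ ^ 2 = ∫⁻ x, ‖f x‖ₑ ^ 2 := by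
  rw [← sq_eLpNorm_two, ← sq_eLpNorm_two, ← eLpNorm_congr_ae (fourier_toLp_ae_eq hf hf2),
    ← eLpNorm_congr_ae hf2.coeFn_toLp, ← Lp.enorm_def, ← Lp.enorm_def, ← ofReal_norm,
    ← ofReal_norm, Lp.norm_fourier_eq]

end Fourier

/-! ### The reference state lies between `0` and `1` -/

lemma spectrum_subset_Icc {H : Type*} [NormedAddCommGroup H] [InnerProductSpace ℂ H]
    [CompleteSpace H] {A : H →L[ℂ] H} (h0 : 0 ≤ A) (h1 : A ≤ 1) :
    spectrum ℝ A ⊆ Set.Icc 0 1 := by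
  intro t ht
  refine ⟨spectrum_nonneg_of_nonneg h0 ht, ?_⟩
  have h : 1 - t ∈ spectrum ℝ (1 - A) := by
    have h2 := spectrum.singleton_sub_eq A (1 : ℝ)
    rw [map_one] at h2
    rw [← h2]
    exact Set.sub_mem_sub rfl ht
  linarith [spectrum_nonneg_of_nonneg (sub_nonneg.2 h1) h]

/-- In Fourier variables, `⟨u, γ_ref u⟩` is the integral of `|û|²` against the symbol. -/
lemma inner_refState (d : ℕ) (S : ℝ → ℝ) (ħ : ℝ) (u w : L2 d) :
    inner ℂ (refState d S ħ u) w = ∫ ξ, (invDeriv S ((2 * Real.pi * ħ * ‖ξ‖) ^ 2) : ℂ) *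
      inner ℂ ((𝓕 u : L2 d) ξ) ((𝓕 w : L2 d) ξ) := by
  rw [← Lp.inner_fourier_eq, L2.inner_def]
  refine integral_congr_ae ((fourier_refState d S ħ u).mono fun ξ hξ => ?_)
  simp only [hξ, refSymbol, RCLike.inner_apply, map_mul, Complex.conj_ofReal]
  ring

lemma refState_nonneg (d : ℕ) (S : ℝ → ℝ) (ħ : ℝ) : 0 ≤ refState d S ħ := by
  rw [ContinuousLinearMap.nonneg_iff_isPositive, ContinuousLinearMap.isPositive_iff_complex]
  intro u
  have h : inner ℂ (refState d S ħ u) u =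
      ((∫ ξ, invDeriv S ((2 * Real.pi * ħ * ‖ξ‖) ^ 2) * ‖(𝓕 u : L2 d) ξ‖ ^ 2 : ℝ) : ℂ) := by
    rw [inner_refState, ← integral_complex_ofReal]
    refine integral_congr_ae (ae_of_all _ fun ξ => ?_)
    simp only [inner_self_eq_norm_sq_to_K]
    push_cast; rfl
  rw [h]
  exact ⟨by simp, by
    simpa using integral_nonneg fun ξ => mul_nonneg (invDeriv_nonneg S _) (sq_nonneg _)⟩

lemma refState_le_one (d : ℕ) (S : ℝ → ℝ) (ħ : ℝ) : refState d S ħ ≤ 1 := by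
  have hsa : IsSelfAdjoint (1 - refState d S ħ) :=
    (IsSelfAdjoint.one _).sub (IsSelfAdjoint.of_nonneg (refState_nonneg d S ħ))
  rw [← sub_nonneg, ContinuousLinearMap.nonneg_iff_isPositive,
    ContinuousLinearMap.isPositive_def]
  refine ⟨hsa.isSymmetric, fun u => ?_⟩
  have hnorm : ‖refState d S ħ u‖ ≤ ‖u‖ := by
    rw [← Lp.norm_fourier_eq, ← Lp.norm_fourier_eq u]
    refine Lp.norm_le_norm_of_ae_le ((fourier_refState d S ħ u).mono fun ξ hξ => ?_)
    rw [hξ, norm_mul]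
    refine mul_le_of_le_one_left (norm_nonneg _) ?_
    rw [refSymbol, Complex.norm_real, Real.norm_eq_abs, abs_of_nonneg (invDeriv_nonneg S _)]
    exact invDeriv_le_one S _
  have h := (re_inner_le_norm (𝕜 := ℂ) (refState d S ħ u) u).trans
    (mul_le_mul_of_nonneg_right hnorm (norm_nonneg u))
  rw [ContinuousLinearMap.reApplyInnerSelf_apply]
  simp only [sub_apply, one_apply_eq_self, inner_sub_left, map_sub]
  rw [inner_self_eq_norm_mul_norm (𝕜 := ℂ)]
  linarith

/-! ### Coherent states -/

section Coherent

variable {d : ℕ} {χ : Space d → ℝ} {ħ : ℝ}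

lemma norm_coherentFun (χ : Space d → ℝ) (ħ : ℝ) (x v z : Space d) :
    ‖coherentFun χ ħ x v z‖ = |ħ ^ (-(d : ℝ) / 4) * χ (ħ ^ (-(1 / 2) : ℝ) • (z - x))| := by
  rw [coherentFun, norm_mul, mul_comm Complex.I, Complex.norm_exp_ofReal_mul_I, mul_one,
    Complex.norm_real, Real.norm_eq_abs]

lemma integral_sq_norm_coherentFun (hχ_norm : ∫ z, χ z ^ 2 = 1) (hħ : 0 < ħ) (x v : Space d) :
    ∫ z, ‖coherentFun χ ħ x v z‖ ^ 2 = 1 := by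
  simp only [norm_coherentFun, sq_abs, mul_pow]
  rw [integral_sub_right_eq_self
    (fun z => (ħ ^ (-(d : ℝ) / 4)) ^ 2 * χ (ħ ^ (-(1 / 2) : ℝ) • z) ^ 2) x,
    integral_const_mul, Measure.integral_comp_smul volume (fun z => χ z ^ 2), hχ_norm]
  rw [finrank_euclideanSpace_fin, abs_of_nonneg (by positivity), smul_eq_mul, mul_one,
    ← Real.rpow_natCast, ← Real.rpow_natCast, ← Real.rpow_mul hħ.le, ← Real.rpow_mul hħ.le,
    ← Real.rpow_neg hħ.le, ← Real.rpow_add hħ]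
  convert Real.rpow_zero ħ using 2
  push_cast
  ring

lemma norm_coherentState (hχ : MemLp χ 2) (hχ_norm : ∫ z, χ z ^ 2 = 1) (hħ : 0 < ħ)
    (x v : Space d) : ‖coherentState hχ hħ x v‖ = 1 := by
  have h := sq_norm_toLp (memLp_coherentFun hχ hħ x v)
  rw [integral_sq_norm_coherentFun hχ_norm hħ] at h
  exact (pow_eq_one_iff_of_nonneg (norm_nonneg _) two_ne_zero).1 h

/-- Changing the velocity multiplies by a phase, so distances between coherent states of equal
velocity do not depend on it. -/
lemma norm_coherentState_sub_same_velocity (hχ : MemLp χ 2) (hħ : 0 < ħ) (x y v : Space d) :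
    ‖coherentState hχ hħ x v - coherentState hχ hħ y v‖ ≤
      ‖coherentState hχ hħ x 0 - coherentState hχ hħ y 0‖ := by
  simp only [coherentState, ← MemLp.toLp_sub]
  refine Lp.norm_le_norm_of_ae_le ?_
  filter_upwards [((memLp_coherentFun hχ hħ x v).sub (memLp_coherentFun hχ hħ y v)).coeFn_toLp,
    ((memLp_coherentFun hχ hħ x 0).sub (memLp_coherentFun hχ hħ y 0)).coeFn_toLp] with z h1 h2
  rw [h1, h2]
  have hphase : ∀ t : ℝ, ‖Complex.exp (Complex.I * t)‖ = 1 := fun t => by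
    rw [mul_comm, Complex.norm_exp_ofReal_mul_I]
  rw [Pi.sub_apply, Pi.sub_apply]
  unfold coherentFun
  rw [← sub_mul, ← sub_mul, norm_mul, norm_mul, hphase, hphase]

lemma continuous_coherentState_position (hχ : MemLp χ 2) (hħ : 0 < ħ) :
    Continuous fun x : Space d => coherentState hχ hħ x 0 := by
  have h : ∀ x, coherentState hχ hħ x 0 = DomAddAct.mk (-x) +ᵥ coherentState hχ hħ 0 0 := by
    intro x
    rw [coherentState, coherentState, DomAddAct.mk_vadd_toLp]
    refine MemLp.toLp_congr _ _ (ae_of_all _ fun z => ?_)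
    simp [coherentFun, sub_eq_neg_add]
  have : Fact ((2 : ℝ≥0∞) ≠ ∞) := ⟨by norm_num⟩
  exact ((DomAddAct.continuous_mk.comp continuous_neg).vadd continuous_const).congr
    fun x => (h x).symm

lemma continuous_coherentState_velocity (hχ : MemLp χ 2) (hħ : 0 < ħ) (x : Space d) :
    Continuous fun v : Space d => coherentState hχ hħ x v := by
  refine continuous_iff_continuousAt.2 fun v₀ => ?_
  rw [ContinuousAt, tendsto_iff_norm_sub_tendsto_zero]
  have hsq : Continuous fun v => ‖coherentState hχ hħ x v - coherentState hχ hħ x v₀‖ ^ 2 := by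
    have h : ∀ v, ‖coherentState hχ hħ x v - coherentState hχ hħ x v₀‖ ^ 2 =
        ∫ z, ‖coherentFun χ ħ x v z - coherentFun χ ħ x v₀ z‖ ^ 2 := fun v => by
      simp only [coherentState, ← MemLp.toLp_sub, sq_norm_toLp, Pi.sub_apply]
    simp only [h]
    refine continuous_of_dominated (bound := fun z => 4 * ‖coherentFun χ ħ x v₀ z‖ ^ 2)
      (fun v => ?_) (fun v => ae_of_all _ fun z => ?_) ?_ (ae_of_all _ fun z => ?_)
    · exact (((memLp_coherentFun hχ hħ x v).sub (memLp_coherentFun hχ hħ x v₀)).1.norm.pow 2)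
    · rw [Real.norm_eq_abs, abs_of_nonneg (by positivity)]
      have h1 := norm_sub_le (coherentFun χ ħ x v z) (coherentFun χ ħ x v₀ z)
      rw [norm_coherentFun χ ħ x v, ← norm_coherentFun χ ħ x v₀ z] at h1
      nlinarith [norm_nonneg (coherentFun χ ħ x v z - coherentFun χ ħ x v₀ z),
        norm_nonneg (coherentFun χ ħ x v₀ z)]
    · exact ((memLp_coherentFun hχ hħ x v₀).integrable_norm_pow (by norm_num)).const_mul 4
    · unfold coherentFun
      fun_prop
  have := (hsq.tendsto v₀).sqrt
  simpa [Real.sqrt_sq (norm_nonneg _)] using this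

lemma continuous_coherentState (hχ : MemLp χ 2) (hħ : 0 < ħ) :
    Continuous fun z : Space d × Space d => coherentState hχ hħ z.1 z.2 := by
  refine continuous_iff_continuousAt.2 fun z₀ => ?_
  rw [ContinuousAt, tendsto_iff_norm_sub_tendsto_zero]
  have h1 : Tendsto (fun z : Space d × Space d =>
      ‖coherentState hχ hħ z.1 0 - coherentState hχ hħ z₀.1 0‖) (𝓝 z₀) (𝓝 0) :=
    tendsto_iff_norm_sub_tendsto_zero.1
      (((continuous_coherentState_position hχ hħ).comp continuous_fst).tendsto z₀)
  have h2 : Tendsto (fun z : Space d × Space d =>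
      ‖coherentState hχ hħ z₀.1 z.2 - coherentState hχ hħ z₀.1 z₀.2‖) (𝓝 z₀) (𝓝 0) :=
    tendsto_iff_norm_sub_tendsto_zero.1
      (((continuous_coherentState_velocity hχ hħ z₀.1).comp continuous_snd).tendsto z₀)
  refine squeeze_zero (fun _ => norm_nonneg _) (fun z => ?_) (by simpa using h1.add h2)
  exact (norm_sub_le_norm_sub_add_norm_sub _ (coherentState hχ hħ z₀.1 z.2) _).trans
    (add_le_add_left (norm_coherentState_sub_same_velocity hχ hħ _ _ _) _)

/-! ### The resolution of the identity by coherent states -/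

/-- `⟨χ_{x,v}, w⟩` is a Fourier integral in the velocity: the windowed Fourier transform of `w`. -/
lemma inner_coherentState (hχ : MemLp χ 2) (hħ : 0 < ħ) (x v : Space d) (w : L2 d) :
    inner ℂ (coherentState hχ hħ x v) w =
      𝓕 (fun z => coherentFun χ ħ 0 0 (z - x) * w z) ((2 * Real.pi * ħ)⁻¹ • v) := by
  rw [L2.inner_def, Real.fourier_eq]
  refine integral_congr_ae ((memLp_coherentFun hχ hħ x v).coeFn_toLp.mono fun z hz => ?_)
  simp only [coherentState]
  rw [hz]
  have hexp : (starRingEnd ℂ) (Complex.exp (Complex.I * ((inner ℝ v z / ħ : ℝ) : ℂ))) =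
      (Real.fourierChar (-inner ℝ z ((2 * Real.pi * ħ)⁻¹ • v)) : ℂ) := by
    rw [Real.fourierChar_apply, ← Complex.exp_conj, map_mul, Complex.conj_I, Complex.conj_ofReal,
      inner_smul_right, real_inner_comm]
    congr 1
    have := Real.pi_ne_zero
    have h : 2 * Real.pi * -((2 * Real.pi * ħ)⁻¹ * inner ℝ z v) = -(inner ℝ z v / ħ) := by
      field_simp
    rw [h]
    push_cast
    ring
  rw [RCLike.inner_apply, coherentFun, map_mul, Complex.conj_ofReal, hexp, Circle.smul_def,
    smul_eq_mul, coherentFun]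
  simp only [sub_zero, inner_zero_left, zero_div, Complex.ofReal_zero, mul_zero, Complex.exp_zero,
    mul_one]
  ring

lemma lintegral_comp_inv_smul {c : ℝ} (hc : 0 < c) {f : Space d → ℝ≥0∞} (hf : Measurable f) :
    ∫⁻ v, f (c⁻¹ • v) = ENNReal.ofReal (c ^ d) * ∫⁻ v, f v := by
  have h := Measure.map_addHaar_smul (volume : Measure (Space d)) (inv_pos.2 hc).ne'
  rw [← lintegral_map hf (measurable_const_smul _), h, lintegral_smul_measure,
    finrank_euclideanSpace_fin, smul_eq_mul, inv_pow, inv_inv, abs_of_pos (by positivity)]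

/-- **Moyal's identity**: integrating `|⟨χ_{x,v}, w⟩|²` over phase space gives `(2πħ)^d ‖w‖²`. The
velocity integral is Plancherel's theorem for `χ(· - x) w`, the position integral is Tonelli. -/
lemma lintegral_enorm_inner_coherentState_sq (hχ : MemLp χ 2) (hχ_norm : ∫ z, χ z ^ 2 = 1)
    (hħ : 0 < ħ) (w : L2 d) :
    ∫⁻ z : Space d × Space d, ‖inner ℂ (coherentState hχ hħ z.1 z.2) w‖ₑ ^ 2 =
      ENNReal.ofReal ((2 * Real.pi * ħ) ^ d) * ‖w‖ₑ ^ 2 := by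
  set q : Space d → ℂ := coherentFun χ ħ 0 0 with hqdef
  have hq : MemLp q 2 := memLp_coherentFun hχ hħ 0 0
  have hw : MemLp w 2 := Lp.memLp w
  have hq1 : ∫⁻ z, ‖q z‖ₑ ^ 2 = 1 := by
    rw [← sq_eLpNorm_two, ← eLpNorm_congr_ae hq.coeFn_toLp, ← Lp.enorm_def, ← ofReal_norm]
    have := norm_coherentState hχ hχ_norm hħ (0 : Space d) 0
    rw [coherentState] at this
    rw [this]
    simp
  have hw1 : ∫⁻ z, ‖w z‖ₑ ^ 2 = ‖w‖ₑ ^ 2 := by rw [← sq_eLpNorm_two, ← Lp.enorm_def]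
  have hqx : ∀ x, MemLp (fun z => q (z - x)) 2 := fun x =>
    hq.comp_measurePreserving (measurePreserving_sub_right volume x)
  have hprod : AEStronglyMeasurable (fun p : Space d × Space d => q (p.2 - p.1) * w p.2)
      (volume.prod volume) := by
    refine AEStronglyMeasurable.mul ?_ hw.1.comp_snd
    have h1 : Measure.QuasiMeasurePreserving (fun p : Space d × Space d => p.1 - p.2)
      (volume.prod volume) volume := quasiMeasurePreserving_sub volume volume
    exact hq.1.comp_quasiMeasurePreserving
      (h1.comp (Measure.measurePreserving_swap).quasiMeasurePreserving)
  have hprod2 : AEMeasurable (fun p : Space d × Space d => ‖q (p.2 - p.1) * w p.2‖ₑ ^ 2)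
      (volume.prod volume) := hprod.enorm.pow_const 2
  have htot : ∫⁻ x, ∫⁻ z, ‖q (z - x) * w z‖ₑ ^ 2 = ‖w‖ₑ ^ 2 := by
    rw [lintegral_lintegral_swap hprod2, ← hw1]
    refine lintegral_congr fun z => ?_
    simp only [enorm_mul, mul_pow]
    rw [lintegral_mul_const' _ _ (by simp), lintegral_sub_left_eq_self (fun x => ‖q x‖ₑ ^ 2) z,
      hq1, one_mul]
  have hfin : ∀ᵐ x, ∫⁻ z, ‖q (z - x) * w z‖ₑ ^ 2 < ∞ :=
    ae_lt_top' hprod2.lintegral_prod_right' (by rw [htot]; simp)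
  have hmeas : Measurable fun z : Space d × Space d =>
      ‖inner ℂ (coherentState hχ hħ z.1 z.2) w‖ₑ ^ 2 :=
    (((continuous_coherentState hχ hħ).inner continuous_const).enorm).measurable.pow_const 2
  have hc : 0 < 2 * Real.pi * ħ := by positivity
  rw [Measure.volume_eq_prod, lintegral_prod _ hmeas.aemeasurable, ← htot,
    ← lintegral_const_mul' _ _ ENNReal.ofReal_ne_top]
  refine lintegral_congr_ae (hfin.mono fun x hx => ?_)
  have hint : Integrable fun z => q (z - x) * w z := (hqx x).integrable_mul hw
  have hmem : MemLp (fun z => q (z - x) * w z) 2 := by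
    refine ⟨hint.1, lt_top_iff_ne_top.2 fun h => ?_⟩
    rw [← sq_eLpNorm_two, h] at hx
    simp at hx
  have hF : Continuous (𝓕 fun z => q (z - x) * w z) := VectorFourier.fourierIntegral_continuous
    Real.continuous_fourierChar (by exact continuous_inner) hint
  simp only [inner_coherentState]
  rw [lintegral_comp_inv_smul hc (f := fun v => ‖𝓕 (fun z => q (z - x) * w z) v‖ₑ ^ 2)
    (hF.enorm.measurable.pow_const 2), lintegral_enorm_fourier_sq hint hmem]

/-- The measure `(2πħ)^{-d} dx dv` on phase space. -/
def phaseMeasure (d : ℕ) (ħ : ℝ) : Measure (Space d × Space d) :=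
  ENNReal.ofReal (((2 * Real.pi * ħ) ^ d)⁻¹) • volume

lemma lintegral_enorm_inner_coherentState_sq_phaseMeasure (hχ : MemLp χ 2)
    (hχ_norm : ∫ z, χ z ^ 2 = 1) (hħ : 0 < ħ) (w : L2 d) :
    ∫⁻ z, ‖inner ℂ (coherentState hχ hħ z.1 z.2) w‖ₑ ^ 2 ∂phaseMeasure d ħ = ‖w‖ₑ ^ 2 := by
  have hc : 0 < (2 * Real.pi * ħ) ^ d := by positivity
  rw [phaseMeasure, lintegral_smul_measure, smul_eq_mul,
    lintegral_enorm_inner_coherentState_sq hχ hχ_norm hħ, ← mul_assoc,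
    ← ENNReal.ofReal_mul (by positivity), inv_mul_cancel₀ hc.ne', ENNReal.ofReal_one, one_mul]

lemma eLpNorm_inner_coherentState (hχ : MemLp χ 2) (hχ_norm : ∫ z, χ z ^ 2 = 1) (hħ : 0 < ħ)
    (w : L2 d) :
    eLpNorm (fun z : Space d × Space d => inner ℂ (coherentState hχ hħ z.1 z.2) w) 2
      (phaseMeasure d ħ) = ‖w‖ₑ := by
  have h := (sq_eLpNorm_two (phaseMeasure d ħ) _).trans
    (lintegral_enorm_inner_coherentState_sq_phaseMeasure hχ hχ_norm hħ w)
  exact (ENNReal.pow_right_strictMono two_ne_zero).injective h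

lemma memLp_inner_coherentState (hχ : MemLp χ 2) (hχ_norm : ∫ z, χ z ^ 2 = 1) (hħ : 0 < ħ)
    (w : L2 d) :
    MemLp (fun z : Space d × Space d => inner ℂ (coherentState hχ hħ z.1 z.2) w) 2
      (phaseMeasure d ħ) :=
  ⟨((continuous_coherentState hχ hħ).inner continuous_const).aestronglyMeasurable, by
    rw [eLpNorm_inner_coherentState hχ hχ_norm hħ]; exact enorm_lt_top⟩

/-- The isometry `w ↦ ((x,v) ↦ ⟨χ_{x,v}, w⟩)` from `L²(ℝ^d)` to `L²` of phase space. -/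
def coherentTransform (hχ : MemLp χ 2) (hχ_norm : ∫ z, χ z ^ 2 = 1) (hħ : 0 < ħ) :
    L2 d →ₗᵢ[ℂ] Lp ℂ 2 (phaseMeasure d ħ) where
  toFun w := (memLp_inner_coherentState hχ hχ_norm hħ w).toLp
  map_add' u w := by
    rw [← MemLp.toLp_add]
    exact MemLp.toLp_congr _ _ (ae_of_all _ fun z => by simp [inner_add_right])
  map_smul' c w := by
    rw [RingHom.id_apply, ← MemLp.toLp_const_smul]
    exact MemLp.toLp_congr _ _ (ae_of_all _ fun z => by simp [inner_smul_right])
  norm_map' w := by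
    change ‖(memLp_inner_coherentState hχ hχ_norm hħ w).toLp‖ = ‖w‖
    rw [Lp.norm_toLp, eLpNorm_inner_coherentState hχ hχ_norm hħ, toReal_enorm]

/-- The coherent states resolve the identity: an isometry preserves inner products. -/
lemma isResolutionOfIdentity_coherentState (hχ : MemLp χ 2) (hχ_norm : ∫ z, χ z ^ 2 = 1)
    (hħ : 0 < ħ) : IsResolutionOfIdentity (phaseMeasure d ħ)
      (fun z : Space d × Space d => coherentState hχ hħ z.1 z.2) := by
  intro u w
  set T := coherentTransform hχ hχ_norm hħ
  have hae : (fun z => inner ℂ (T u z) (T w z)) =ᵐ[phaseMeasure d ħ] fun z =>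
      inner ℂ u (coherentState hχ hħ z.1 z.2) * inner ℂ (coherentState hχ hħ z.1 z.2) w := by
    filter_upwards [(memLp_inner_coherentState hχ hχ_norm hħ u).coeFn_toLp,
      (memLp_inner_coherentState hχ hχ_norm hħ w).coeFn_toLp] with z h1 h2
    change inner ℂ ((memLp_inner_coherentState hχ hχ_norm hħ u).toLp _ z)
      ((memLp_inner_coherentState hχ hχ_norm hħ w).toLp _ z) = _
    rw [h1, h2, RCLike.inner_apply, inner_conj_symm, mul_comm]
  exact ⟨(L2.integrable_inner (T u) (T w)).congr hae, by
    rw [← integral_congr_ae hae, ← L2.inner_def, LinearIsometry.inner_map_map]⟩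

end Coherent

/-! ### Phase space as a Euclidean space -/

lemma finrank_phaseSpace (d : ℕ) :
    Module.finrank ℝ (WithLp 2 (Space d × Space d)) = d + d := by
  rw [(WithLp.linearEquiv 2 ℝ (Space d × Space d)).finrank_eq, Module.finrank_prod,
    finrank_euclideanSpace_fin]

/-- The identification of `ℝ^{2d}` with phase space through an orthonormal basis. -/
def phaseHomeomorph (d : ℕ) : EuclideanSpace ℝ (Fin (d + d)) ≃ₜ Space d × Space d :=
  ((stdOrthonormalBasis ℝ (WithLp 2 (Space d × Space d))).reindex
    (finCongr (finrank_phaseSpace d))).repr.symm.toHomeomorph.trans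
    (WithLp.homeomorphProd 2 (Space d) (Space d))

lemma measurePreserving_phaseHomeomorph (d : ℕ) :
    MeasurePreserving (phaseHomeomorph d) volume volume :=
  (WithLp.volume_preserving_ofLp (Space d) (Space d)).comp
    (((stdOrthonormalBasis ℝ (WithLp 2 (Space d × Space d))).reindex
      (finCongr (finrank_phaseSpace d))).repr.symm.measurePreserving)

lemma IsResolutionOfIdentity.comp_measurePreserving {H X Y : Type*} [NormedAddCommGroup H]
    [InnerProductSpace ℂ H] [MeasurableSpace X] [MeasurableSpace Y] {μ : Measure X}
    {ν : Measure Y} {n : Y → H} (hn : IsResolutionOfIdentity ν n) {f : X → Y}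
    (hf : MeasurePreserving f μ ν) (hf' : MeasurableEmbedding f) :
    IsResolutionOfIdentity μ (n ∘ f) := fun u w =>
  ⟨(hf.integrable_comp_emb hf').2 (hn u w).1, (hf.integral_comp hf' _).trans (hn u w).2⟩

end BerezinLieb

open BerezinLieb

theorem proposition4p3 {d : ℕ} (hd : 1 ≤ d) {S : ℝ → ℝ} {C : ℝ}
    (hS : BerezinLieb.AdmissibleEntropy d S)
    (hBL : BerezinLieb.HasBerezinLiebProperty S C)
    {χ : BerezinLieb.Space d → ℝ} (hχ : MemLp χ 2) (hχ_norm : ∫ z, χ z ^ 2 = 1)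
    {ħ : ℝ} (hħ : 0 < ħ)
    {γ : BerezinLieb.L2 d →L[ℂ] BerezinLieb.L2 d}
    (hγ : γ ∈ BerezinLieb.freeEnergySpace d S ħ) :
    BerezinLieb.classicalRelEntropy S
        (BerezinLieb.husimi hχ hħ γ)
        (BerezinLieb.husimi hχ hħ (BerezinLieb.refState d S ħ))
      ≤ ENNReal.ofReal (C * ħ ^ d) *
        BerezinLieb.quantumRelEntropy S γ (BerezinLieb.refState d S ħ) := by
  obtain ⟨hsa, h0, h1, -⟩ := hγ
  set ν := phaseMeasure d ħ with hν
  have hemb := (phaseHomeomorph d).measurableEmbedding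
  have hpres : MeasurePreserving (phaseHomeomorph d)
      (ENNReal.ofReal (((2 * Real.pi * ħ) ^ d)⁻¹) • volume) ν :=
    (measurePreserving_phaseHomeomorph d).smul_measure _
  have key := hBL.2 (L2 d) (d + d) _ _
    ((continuous_coherentState hχ hħ).comp (phaseHomeomorph d).continuous)
    (fun x => norm_coherentState hχ hχ_norm hħ _ _)
    ((isResolutionOfIdentity_coherentState hχ hχ_norm hħ).comp_measurePreserving hpres hemb)
    γ (refState d S ħ) hsa (IsSelfAdjoint.of_nonneg (refState_nonneg d S ħ))
    (spectrum_subset_Icc h0 h1)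
    (spectrum_subset_Icc (refState_nonneg d S ħ) (refState_le_one d S ħ))
  have htransfer := hpres.lintegral_comp_emb hemb fun z =>
    scalarRelEntropy S (husimi hχ hħ γ z) (husimi hχ hħ (refState d S ħ) z)
  have key' := htransfer.symm.le.trans key
  rw [hν, phaseMeasure, lintegral_smul_measure, smul_eq_mul] at key'
  -- The normalizations differ by the factor `ħ ^ d`.
  have hscale : ENNReal.ofReal (1 / (2 * Real.pi) ^ d) =
      ENNReal.ofReal (ħ ^ d) * ENNReal.ofReal (((2 * Real.pi * ħ) ^ d)⁻¹) := by
    rw [← ENNReal.ofReal_mul (by positivity), mul_pow (2 * Real.pi) ħ d]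
    congr 1
    field_simp
  rw [classicalRelEntropy, hscale, mul_comm C, ENNReal.ofReal_mul (by positivity),
    mul_assoc (ENNReal.ofReal (ħ ^ d)), mul_assoc (ENNReal.ofReal (ħ ^ d))]
  exact mul_le_mul_right key' _

end
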